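/- Let $M_d$ be the algebra of complex $d\times d$ matrices, $M_d^+$ its cone of positive semidefinite matrices, and call $\rho\in M_d^+$ with $\operatorname{Tr}\rho=1$ a state. A \emph{convex $M_d$-corner} is a non-empty closed convex set $\mathcal A\subseteq M_d^+$ such that $B\in\mathcal A$ and $0\le A\le B$ imply $A\in\mathcal A$; it is \emph{standard} if it is bounded and has non-empty interior relative to $M_d^+$. The \emph{anti-blocker} of a set $\mathcal A\subseteq M_d^+$ is $\mathcal A^\sharp=\{N\in M_d^+:\operatorname{Tr}(NM)\le 1\text{ for all }M\in\mathcal A\}$. For convex $M_{d_i}$-corners $\mathcal A_i$ ($i=1,2$), let $\mathcal A_1\otimes_{\max}\mathcal A_2$ be the smallest convex $M_{d_1d_2}$-corner that contains all $A_1\otimes A_2$ with $A_i\in\mathcal A_i$, and let $\mathcal A_1\otimes_{\min}\mathcal A_2=(\mathcal A_1^\sharp\otimes_{\max}\mathcal A_2^\sharp)^\sharp$. For $\rho,A\in M_d^+$ with $A=\sum_{i=1}^d\lambda_iu_iu_i^*$, $(u_i)$ an orthonormal basis, put $-\operatorname{Tr}(\rho\log A)=-\sum_{i}\langle\rho u_i,u_i\rangle\log\lambda_i$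 (terms with $\lambda_i=0$ being $0$) if $\ker A\subseteq\ker\rho$, and $-\operatorname{Tr}(\rho\log A)=+\infty$ otherwise. For a bounded convex $M_d$-corner $\mathcal A$ and a state $\rho\in M_d$, the \emph{entropy} of $\rho$ over $\mathcal A$ is $H_{\mathcal A}(\rho)=\min_{A\in\mathcal A}-\operatorname{Tr}(\rho\log A)$. For an orthonormal basis $V=(v_i)_{i=1}^d$ of $\mathbb C^d$ let $\mathcal D_V=\operatorname{span}\{v_iv_i^*\}$ and $\Delta_V(A)=\sum_i\langle Av_i,v_i\rangle v_iv_i^*$; a convex $M_d$-corner $\mathcal A$ is \emph{$V$-aligned} if $\Delta_V(\mathcal A)\subseteq\mathcal A$. For a state $\rho$ in $M_{d_1}\otimes M_{d_2}$ let $\operatorname{Tr}_i\rho\in M_{d_i}$ denote its reduced state on the $i$-th factor, so that $\operatorname{Tr}((\operatorname{Tr}_1\rho)A_1)=\operatorname{Tr}(\rho(A_1\otimes I))$ for all $A_1\in M_{d_1}$, and similarly for $\operatorname{Tr}_2\rho$. \textbf{Theorem.} Let $\mathcal A_i$ be a standard convex $M_{d_i}$-corner, $i=1,2$, and let $\tau\in\{\min,\max\}$.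 For every state $\rho$ in $M_{d_1}\otimes M_{d_2}$, $$H_{\mathcal A_1\otimes_\tau\mathcal A_2}(\rho)\le H_{\mathcal A_1}(\operatorname{Tr}_1\rho)+H_{\mathcal A_2}(\operatorname{Tr}_2\rho).$$ If, moreover, $V_i$ is an orthonormal basis of $\mathbb C^{d_i}$, $\mathcal A_i$ is $V_i$-aligned and $\rho_i\in\mathcal D_{V_i}$ is a state in $M_{d_i}$, $i=1,2$, then $$H_{\mathcal A_1\otimes_\tau\mathcal A_2}(\rho_1\otimes\rho_2)=H_{\mathcal A_1}(\rho_1)+H_{\mathcal A_2}(\rho_2).$$ -/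

import Mathlib

open Matrix
open scoped Kronecker ComplexOrder

namespace ConvexCorner

/-- A state (density matrix): a positive semidefinite complex matrix of trace one. -/
def IsState {n : Type*} [Fintype n] (ρ : Matrix n n ℂ) : Prop :=
  ρ.PosSemidef ∧ ρ.trace = 1

/-- A (non-commutative) convex corner: a non-empty, closed, convex, hereditary set of positive
semidefinite matrices. -/
structure IsConvexCorner {n : Type*} (𝒜 : Set (Matrix n n ℂ)) : Prop where
  nonempty : 𝒜.Nonempty
  posSemidef : ∀ A ∈ 𝒜, A.PosSemidef
  isClosed : IsClosed 𝒜
  convex : Convex ℝ 𝒜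
  hereditary : ∀ A B : Matrix n n ℂ, B ∈ 𝒜 → A.PosSemidef → (B - A).PosSemidef → A ∈ 𝒜

/-- The squared Hilbert-Schmidt norm of a matrix. -/
noncomputable def hsNormSq {n : Type*} [Fintype n] (M : Matrix n n ℂ) : ℝ :=
  ∑ i, ∑ j, ‖M i j‖ ^ 2

/-- A standard convex corner: it is bounded, and it has non-empty interior relative to the cone of
positive semidefinite matrices. -/
structure IsStandard {n : Type*} [Fintype n] (𝒜 : Set (Matrix n n ℂ)) : Prop
    extends IsConvexCorner 𝒜 where
  bounded : ∃ R : ℝ, ∀ A ∈ 𝒜, hsNormSq A ≤ R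
  relInterior : ∃ A ∈ 𝒜, ∃ δ : ℝ, 0 < δ ∧
    ∀ B : Matrix n n ℂ, B.PosSemidef → hsNormSq (B - A) < δ ^ 2 → B ∈ 𝒜

/-- The smallest convex corner containing `𝒢` (for a non-empty set `𝒢` of positive semidefinite
matrices). -/
def cornerHull {n : Type*} (𝒢 : Set (Matrix n n ℂ)) : Set (Matrix n n ℂ) :=
  ⋂₀ {𝒞 | IsConvexCorner 𝒞 ∧ 𝒢 ⊆ 𝒞}

/-- The anti-blocker. For positive semidefinite `N` and `M` the trace of `N * M` is real. -/
def antiBlocker {n : Type*} [Fintype n] (𝒜 : Set (Matrix n n ℂ)) : Set (Matrix n n ℂ) :=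
  {N | N.PosSemidef ∧ ∀ M ∈ 𝒜, (N * M).trace.re ≤ 1}

/-- The maximal tensor product of two convex corners. -/
def maxTensor {m n : Type*} (𝒜 : Set (Matrix m m ℂ)) (ℬ : Set (Matrix n n ℂ)) :
    Set (Matrix (m × n) (m × n) ℂ) :=
  cornerHull {X | ∃ A ∈ 𝒜, ∃ B ∈ ℬ, X = A ⊗ₖ B}

/-- The minimal tensor product of two convex corners. -/
def minTensor {m n : Type*} [Fintype m] [Fintype n]
    (𝒜 : Set (Matrix m m ℂ)) (ℬ : Set (Matrix n n ℂ)) :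
    Set (Matrix (m × n) (m × n) ℂ) :=
  antiBlocker (maxTensor (antiBlocker 𝒜) (antiBlocker ℬ))

/-- The reduced matrix of `ρ` on the first tensor factor (the second factor is traced out). -/
def reduced₁ {m n : Type*} [Fintype n] (ρ : Matrix (m × n) (m × n) ℂ) : Matrix m m ℂ :=
  Matrix.of fun i i' => ∑ j, ρ (i, j) (i', j)

/-- The reduced matrix of `ρ` on the second tensor factor (the first factor is traced out). -/
def reduced₂ {m n : Type*} [Fintype m] (ρ : Matrix (m × n) (m × n) ℂ) : Matrix n n ℂ :=
  Matrix.of fun j j' => ∑ i, ρ (i, j) (i, j')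

/-- The defining duality of the first reduced matrix. -/
theorem trace_reduced₁_mul {m n : Type*} [Fintype m] [Fintype n] [DecidableEq n]
    (ρ : Matrix (m × n) (m × n) ℂ) (A : Matrix m m ℂ) :
    (reduced₁ ρ * A).trace = (ρ * (A ⊗ₖ (1 : Matrix n n ℂ))).trace := by
  simp only [Matrix.trace, Matrix.diag, Matrix.mul_apply, reduced₁, Matrix.of_apply,
    Fintype.sum_prod_type, Matrix.kroneckerMap_apply, Matrix.one_apply, mul_ite, mul_one, mul_zero,
    Finset.sum_ite_eq', Finset.mem_univ, if_true, Finset.sum_mul]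
  exact Finset.sum_congr rfl fun _ _ => Finset.sum_comm

/-- The defining duality of the second reduced matrix. -/
theorem trace_reduced₂_mul {m n : Type*} [Fintype m] [Fintype n] [DecidableEq m]
    (ρ : Matrix (m × n) (m × n) ℂ) (B : Matrix n n ℂ) :
    (reduced₂ ρ * B).trace = (ρ * ((1 : Matrix m m ℂ) ⊗ₖ B)).trace := by
  simp only [Matrix.trace, Matrix.diag, Matrix.mul_apply, reduced₂, Matrix.of_apply,
    Fintype.sum_prod_type, Matrix.kroneckerMap_apply, Matrix.one_apply, ite_mul, one_mul, zero_mul,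
    mul_ite, mul_zero, Finset.sum_mul]
  simp only [Finset.sum_comm (s := (Finset.univ : Finset m)) (t := (Finset.univ : Finset n)),
    Finset.sum_ite_eq', Finset.mem_univ, if_true]

open Classical in
/-- The extended real number `-Tr(ρ log A)`, for positive semidefinite `ρ` and `A`: it is `+∞`
unless `ker A ⊆ ker ρ`. In the remaining case `cfc Real.log A` is the functional calculus of the
Hermitian matrix `A` with the convention `log 0 = 0`, so that the kernel of `A`, on which `ρ`
vanishes, contributes nothing. -/
noncomputable def negTrLog {n : Type*} [Fintype n] [DecidableEq n] (ρ A : Matrix n n ℂ) : EReal :=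
  if ∀ v : n → ℂ, A *ᵥ v = 0 → ρ *ᵥ v = 0 then
    ((-(ρ * cfc Real.log A).trace.re : ℝ) : EReal)
  else ⊤

/-- The spectral formula for the trace in `negTrLog`. -/
theorem trace_mul_cfc_log {n : Type*} [Fintype n] [DecidableEq n] (ρ A : Matrix n n ℂ)
    (hA : A.IsHermitian) :
    (ρ * cfc Real.log A).trace =
      ∑ i, (star (hA.eigenvectorBasis i).ofLp ⬝ᵥ (ρ *ᵥ (hA.eigenvectorBasis i).ofLp)) *
        (Real.log (hA.eigenvalues i) : ℂ) := by
  rw [hA.cfc_eq, Matrix.IsHermitian.cfc, Unitary.conjStarAlgAut_apply, ← mul_assoc,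
    Matrix.trace_mul_comm, ← mul_assoc, ← mul_assoc, Matrix.trace]
  refine Finset.sum_congr rfl fun i _ => ?_
  rw [Matrix.diag_apply, Matrix.mul_diagonal]
  congr 1
  simp only [Matrix.mul_apply, dotProduct, Matrix.mulVec, Matrix.star_apply, Pi.star_apply,
    Matrix.IsHermitian.eigenvectorUnitary_apply, Finset.sum_mul, Finset.mul_sum, mul_assoc]
  exact Finset.sum_comm

/-- The entropy of the state `ρ` over the (bounded) convex corner `𝒜`: the least value of
`-Tr(ρ log A)`, `A ∈ 𝒜`, in the extended reals. -/
noncomputable def entropy {n : Type*} [Fintype n] [DecidableEq n]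
    (𝒜 : Set (Matrix n n ℂ)) (ρ : Matrix n n ℂ) : EReal :=
  ⨅ A ∈ 𝒜, negTrLog ρ A

/-- The rank one matrix `v vᴴ`. -/
def rankOne {n : Type*} (v : EuclideanSpace ℂ n) : Matrix n n ℂ :=
  Matrix.vecMulVec v.ofLp (star v.ofLp)

/-- The algebra `𝒟_V` of matrices that are diagonal in the orthonormal basis `V`. -/
def diagonalIn {n : Type*} [Fintype n] (V : OrthonormalBasis n ℂ (EuclideanSpace ℂ n)) :
    Submodule ℂ (Matrix n n ℂ) :=
  Submodule.span ℂ (Set.range fun i => rankOne (V i))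

/-- The diagonal expectation `Δ_V` of the orthonormal basis `V`. -/
noncomputable def diagExpectation {n : Type*} [Fintype n]
    (V : OrthonormalBasis n ℂ (EuclideanSpace ℂ n)) (A : Matrix n n ℂ) : Matrix n n ℂ :=
  ∑ i, (star (V i).ofLp ⬝ᵥ (A *ᵥ (V i).ofLp)) • rankOne (V i)

/-- A set of matrices is `V`-aligned if the diagonal expectation of `V` maps it into itself. -/
def IsAligned {n : Type*} [Fintype n] (V : OrthonormalBasis n ℂ (EuclideanSpace ℂ n))
    (𝒜 : Set (Matrix n n ℂ)) : Prop :=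
  ∀ A ∈ 𝒜, diagExpectation V A ∈ 𝒜

end ConvexCorner

/-! Upper bound: for positive definite `A`, `B` one has log(A ⊗ B) = log A ⊗ 1 + 1 ⊗ log B, so -Tr(ρ
log(A ⊗ B)) is the sum of the two marginal values (`negTrLog_kronecker`). Positive definite members
suffice, since a standard corner contains some c·1, c > 0, and mixing in a little of it costs
arbitrarily little (`negTrLog_smul_add_le`). Products lie in the maximal tensor product, which is
contained in the minimal one.

Lower bound, needed only for the minimal product: let p, q be the eigenvalues of the two states.
Over 𝒜₁ maximise the product of the diagonal entries in the basis V₁, raised to the powers pᵢ. First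
order optimality at the maximiser, with entries aᵢ, says that diag(pᵢ/aᵢ) lies in the anti-blocker
(`IsStandard.exists_optimal`); likewise diag(qⱼ/bⱼ) for 𝒜₂. Their tensor product pairs to at most 1
with every M in the minimal product. The tangent bound log x ≤ x/c + log c - 1 at c = aᵢbⱼ then
gives -Tr(ρ log M) ≥ -∑ pᵢ log aᵢ - ∑ qⱼ log bⱼ. Alignment puts diag(a), diag(b) back into the
corners, so the right side is at least the sum of the entropies. -/

namespace ConvexCorner

/-! ### Diagonal entries in a given basis. -/

section DiagCoeff

variable {n : Type*} [Fintype n]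

/-- The real parts of the diagonal entries of `A` in the basis given by the columns of `U`. -/
noncomputable def diagCoeff (U A : Matrix n n ℂ) (i : n) : ℝ :=
  ((star U * A * U) i i).re

theorem diagCoeff_nonneg (U : Matrix n n ℂ) {A : Matrix n n ℂ} (hA : A.PosSemidef) (i : n) :
    0 ≤ diagCoeff U A i := by
  have := (hA.conjTranspose_mul_mul_same U).diag_nonneg (i := i)
  exact (Complex.le_def.1 this).1

theorem diagCoeff_add (U A B : Matrix n n ℂ) (i : n) :
    diagCoeff U (A + B) i = diagCoeff U A i + diagCoeff U B i := by
  simp [diagCoeff, mul_add, add_mul]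

theorem diagCoeff_smul (U : Matrix n n ℂ) (c : ℝ) (A : Matrix n n ℂ) (i : n) :
    diagCoeff U (c • A) i = c * diagCoeff U A i := by
  simp [diagCoeff]

theorem continuous_diagCoeff (U : Matrix n n ℂ) (i : n) :
    Continuous fun A => diagCoeff U A i := by
  unfold diagCoeff
  refine Complex.continuous_re.comp ?_
  exact ((continuous_const.matrix_mul continuous_id).matrix_mul continuous_const).matrix_elem i i

end DiagCoeff

/-! ### Functional calculus and logarithms in an arbitrary eigenbasis. -/

section Spectral

variable {m n : Type*} [Fintype m] [DecidableEq m] [Fintype n] [DecidableEq n]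

/-- The matrix with real eigenvalues `d` in the basis given by the columns of `U`. -/
noncomputable def conjDiag (U : Matrix n n ℂ) (d : n → ℝ) : Matrix n n ℂ :=
  U * diagonal (fun i => (d i : ℂ)) * star U

theorem exists_eq_conjDiag {A : Matrix n n ℂ} (hA : A.IsHermitian) :
    ∃ U ∈ unitaryGroup n ℂ, ∃ a : n → ℝ, A = conjDiag U a :=
  ⟨hA.eigenvectorUnitary, hA.eigenvectorUnitary.2, hA.eigenvalues, by
    conv_lhs => rw [hA.spectral_theorem, Unitary.conjStarAlgAut_apply]
    rfl⟩

theorem conjDiag_isHermitian (U : Matrix n n ℂ) (d : n → ℝ) : (conjDiag U d).IsHermitian := by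
  rw [conjDiag, star_eq_conjTranspose]
  refine isHermitian_mul_mul_conjTranspose _ ?_
  exact isHermitian_diagonal_of_self_adjoint _ (by ext i; simp)

theorem conjDiag_posSemidef (U : Matrix n n ℂ) {d : n → ℝ} (hd : ∀ i, 0 ≤ d i) :
    (conjDiag U d).PosSemidef := by
  rw [conjDiag, star_eq_conjTranspose]
  refine PosSemidef.mul_mul_conjTranspose_same (PosSemidef.diagonal fun i => ?_) _
  simpa using hd i

theorem conjDiag_add (U : Matrix n n ℂ) (d e : n → ℝ) :
    conjDiag U (fun i => d i + e i) = conjDiag U d + conjDiag U e := by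
  simp only [conjDiag, ← add_mul, ← mul_add, diagonal_add, Complex.ofReal_add]

theorem conjDiag_smul (U : Matrix n n ℂ) (c : ℝ) (d : n → ℝ) :
    conjDiag U (fun i => c * d i) = c • conjDiag U d := by
  have : diagonal (fun i => ((c * d i : ℝ) : ℂ)) = c • diagonal (fun i => (d i : ℂ)) := by
    ext i j
    by_cases h : i = j <;> simp [h]
  simp only [conjDiag, this, mul_smul_comm, smul_mul_assoc]

theorem conjDiag_const {U : Matrix n n ℂ} (hU : U ∈ unitaryGroup n ℂ) (c : ℝ) :
    conjDiag U (fun _ => c) = c • (1 : Matrix n n ℂ) := by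
  have h1 : conjDiag U (fun _ => 1) = 1 := by
    simp [conjDiag, mem_unitaryGroup_iff.1 hU]
  rw [← h1, ← conjDiag_smul]
  simp

theorem conjDiag_kronecker (U : Matrix m m ℂ) (V : Matrix n n ℂ) (a : m → ℝ) (b : n → ℝ) :
    conjDiag U a ⊗ₖ conjDiag V b = conjDiag (U ⊗ₖ V) (fun x => a x.1 * b x.2) := by
  simp only [conjDiag, mul_kronecker_mul, diagonal_kronecker_diagonal, star_eq_conjTranspose,
    conjTranspose_kronecker, Complex.ofReal_mul]

theorem trace_mul_conjDiag (U A : Matrix n n ℂ) (d : n → ℝ) :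
    (A * conjDiag U d).trace.re = ∑ i, diagCoeff U A i * d i := by
  rw [conjDiag, ← mul_assoc, trace_mul_comm, ← mul_assoc, ← mul_assoc, Matrix.trace,
    Complex.re_sum]
  refine Finset.sum_congr rfl fun i _ => ?_
  rw [diag_apply, mul_diagonal, Complex.re_mul_ofReal]
  rfl

theorem diagCoeff_conjDiag {U : Matrix n n ℂ} (hU : U ∈ unitaryGroup n ℂ) (d : n → ℝ) (i : n) :
    diagCoeff U (conjDiag U d) i = d i := by
  have h := mem_unitaryGroup_iff'.1 hU
  have : star U * conjDiag U d * U = diagonal (fun i => (d i : ℂ)) := by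
    rw [conjDiag, mul_assoc, mul_assoc, h, mul_one, ← mul_assoc, h, one_mul]
  simp [diagCoeff, this]

theorem diagCoeff_one {U : Matrix n n ℂ} (hU : U ∈ unitaryGroup n ℂ) (i : n) :
    diagCoeff U 1 i = 1 := by
  simp [diagCoeff, mem_unitaryGroup_iff'.1 hU]

theorem sum_diagCoeff {U : Matrix n n ℂ} (hU : U ∈ unitaryGroup n ℂ) (A : Matrix n n ℂ) :
    ∑ i, diagCoeff U A i = A.trace.re := by
  have := trace_mul_conjDiag U A (fun _ => 1)
  rw [conjDiag_const hU] at this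
  simpa using this.symm

/-- The unitary `star W * U` between two eigenbases intertwines the eigenvalues, so a nonzero entry
forces the two eigenvalues it links to agree. Hence it intertwines their images under `f` as well.
-/
theorem cfc_conjDiag {U : Matrix n n ℂ} (hU : U ∈ unitaryGroup n ℂ) (d : n → ℝ) (f : ℝ → ℝ) :
    cfc f (conjDiag U d) = conjDiag U (fun i => f (d i)) := by
  have hA := conjDiag_isHermitian U d
  set W : Matrix n n ℂ := hA.eigenvectorUnitary.1
  have hW : W ∈ unitaryGroup n ℂ := hA.eigenvectorUnitary.2
  have hspec : conjDiag U d = conjDiag W hA.eigenvalues := by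
    conv_lhs => rw [hA.spectral_theorem, Unitary.conjStarAlgAut_apply]
    rfl
  have hcfc : cfc f (conjDiag U d) = conjDiag W (fun i => f (hA.eigenvalues i)) := by
    rw [hA.cfc_eq, Matrix.IsHermitian.cfc, Unitary.conjStarAlgAut_apply]
    rfl
  rw [hcfc]
  have hU' := mem_unitaryGroup_iff'.1 hU
  have hW' := mem_unitaryGroup_iff'.1 hW
  have hWW := mem_unitaryGroup_iff.1 hW
  have hUU := mem_unitaryGroup_iff.1 hU
  have key : diagonal (fun i => (hA.eigenvalues i : ℂ)) * (star W * U)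
      = (star W * U) * diagonal (fun i => (d i : ℂ)) := by
    have h := congrArg (fun X => star W * X * U) hspec
    simp only [conjDiag] at h
    calc _ = star W * W * diagonal (fun i => (hA.eigenvalues i : ℂ)) * (star W * U) := by
            rw [hW', one_mul]
      _ = star W * (W * diagonal (fun i => (hA.eigenvalues i : ℂ)) * star W) * U := by
            simp only [mul_assoc]
      _ = star W * (U * diagonal (fun i => (d i : ℂ)) * star U) * U := h.symm
      _ = (star W * U) * diagonal (fun i => (d i : ℂ)) * (star U * U) := by
            simp only [mul_assoc]
      _ = _ := by rw [hU', mul_one]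
  have key' : diagonal (fun i => (f (hA.eigenvalues i) : ℂ)) * (star W * U)
      = (star W * U) * diagonal (fun i => (f (d i) : ℂ)) := by
    ext k j
    have h := congrFun (congrFun key k) j
    rw [diagonal_mul, mul_diagonal, mul_comm] at h ⊢
    by_cases h0 : (star W * U) k j = 0
    · simp [h0]
    · have h1 := mul_left_cancel₀ h0 h
      rw [Complex.ofReal_inj.1 h1]
  calc conjDiag W (fun i => f (hA.eigenvalues i))
      = W * diagonal (fun i => (f (hA.eigenvalues i) : ℂ)) * star W * (U * star U) := by
        rw [hUU, mul_one, conjDiag]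
    _ = W * (diagonal (fun i => (f (hA.eigenvalues i) : ℂ)) * (star W * U)) * star U := by
        simp only [mul_assoc]
    _ = (W * star W) * U * diagonal (fun i => (f (d i) : ℂ)) * star U := by
        rw [key']; simp only [mul_assoc]
    _ = _ := by rw [hWW, one_mul, conjDiag]

theorem conjDiag_mulVec_eq_zero_iff {U : Matrix n n ℂ} (hU : U ∈ unitaryGroup n ℂ) (d : n → ℝ)
    (v : n → ℂ) : conjDiag U d *ᵥ v = 0 ↔ ∀ i, d i = 0 ∨ (star U *ᵥ v) i = 0 := by
  have h1 : conjDiag U d *ᵥ v = U *ᵥ (diagonal (fun i => (d i : ℂ)) *ᵥ (star U *ᵥ v)) := by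
    simp [conjDiag, mulVec_mulVec, mul_assoc]
  have h2 : ∀ w : n → ℂ, U *ᵥ w = 0 ↔ w = 0 := fun w => by
    refine ⟨fun h => ?_, fun h => by simp [h]⟩
    have := congrArg (fun x => star U *ᵥ x) h
    simpa [mulVec_mulVec, mem_unitaryGroup_iff'.1 hU] using this
  rw [h1, h2, funext_iff]
  simp [mulVec_diagonal]

/-- The kernel condition in `negTrLog`, read in an eigenbasis. -/
theorem diagCoeff_eq_zero_of_ker {U : Matrix n n ℂ} (hU : U ∈ unitaryGroup n ℂ) {d : n → ℝ}
    {ρ : Matrix n n ℂ} (h : ∀ v : n → ℂ, conjDiag U d *ᵥ v = 0 → ρ *ᵥ v = 0) {i : n}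
    (hi : d i = 0) : diagCoeff U ρ i = 0 := by
  have h1 : conjDiag U d *ᵥ (U *ᵥ Pi.single i 1) = 0 := by
    rw [conjDiag_mulVec_eq_zero_iff hU]
    intro j
    rw [mulVec_mulVec, mem_unitaryGroup_iff'.1 hU, one_mulVec]
    by_cases hj : j = i
    · exact Or.inl (hj ▸ hi)
    · exact Or.inr (by simp [hj])
  have h2 : (star U * ρ * U) i i = (star U *ᵥ (ρ *ᵥ (U *ᵥ Pi.single i 1))) i := by
    rw [mulVec_mulVec, mulVec_mulVec, mulVec_single_one, mul_assoc]
    rfl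
  rw [diagCoeff, h2, h _ h1, mulVec_zero, Pi.zero_apply, Complex.zero_re]

theorem trace_mul_cfc_conjDiag {U : Matrix n n ℂ} (hU : U ∈ unitaryGroup n ℂ) (d : n → ℝ)
    (f : ℝ → ℝ) (ρ : Matrix n n ℂ) :
    (ρ * cfc f (conjDiag U d)).trace.re = ∑ i, diagCoeff U ρ i * f (d i) := by
  rw [cfc_conjDiag hU, trace_mul_conjDiag]

theorem conjDiag_posDef_iff {U : Matrix n n ℂ} (hU : U ∈ unitaryGroup n ℂ) {d : n → ℝ} :
    (conjDiag U d).PosDef ↔ ∀ i, 0 < d i := by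
  rw [conjDiag, Matrix.IsUnit.posDef_star_right_conjugate_iff, posDef_diagonal_iff]
  · simp
  · exact (Unitary.toUnits ⟨U, hU⟩).isUnit

theorem negTrLog_of_posDef (ρ : Matrix n n ℂ) {A : Matrix n n ℂ} (hA : A.PosDef) :
    negTrLog ρ A = ((-(ρ * cfc Real.log A).trace.re : ℝ) : EReal) := by
  refine if_pos fun v hv => ?_
  have : v = 0 := by
    by_contra h
    have := hA.dotProduct_mulVec_pos h
    simp [hv] at this
  simp [this]

/-- Adding a multiple of the identity to `s • A` changes `-Tr(ρ log A)` by at most `-log s`. -/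
theorem negTrLog_smul_add_le {ρ A : Matrix n n ℂ} (hρ : ρ.PosSemidef) (hA : A.PosSemidef)
    {s c : ℝ} (hs : 0 < s) (hc : 0 < c) :
    negTrLog ρ (s • A + c • 1) ≤ negTrLog ρ A + ((-(Real.log s) * ρ.trace.re : ℝ) : EReal) := by
  obtain ⟨U, hU, a, rfl⟩ := exists_eq_conjDiag hA.1
  have ha : ∀ i, 0 ≤ a i := fun i => by
    simpa [diagCoeff_conjDiag hU] using diagCoeff_nonneg U hA i
  by_cases hker : ∀ v : n → ℂ, conjDiag U a *ᵥ v = 0 → ρ *ᵥ v = 0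
  · have heq : s • conjDiag U a + c • 1 = conjDiag U (fun i => s * a i + c) := by
      rw [conjDiag_add U (fun i => s * a i), conjDiag_smul, conjDiag_const hU]
    have hpos : ∀ i, 0 < s * a i + c := fun i => by have := ha i; positivity
    rw [heq, negTrLog_of_posDef _ ((conjDiag_posDef_iff hU).2 hpos), negTrLog, if_pos hker,
      ← EReal.coe_add, EReal.coe_le_coe_iff, trace_mul_cfc_conjDiag hU, trace_mul_cfc_conjDiag hU,
      ← sum_diagCoeff hU ρ, Finset.mul_sum, ← Finset.sum_neg_distrib, ← Finset.sum_neg_distrib,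
      ← Finset.sum_add_distrib]
    refine Finset.sum_le_sum fun i _ => ?_
    -- By the kernel condition a zero eigenvalue of `A` carries no weight of `ρ`, so the convention
    -- log 0 = 0 does no harm.
    rcases (ha i).eq_or_lt with h0 | h0
    · simp [diagCoeff_eq_zero_of_ker hU hker h0.symm]
    · have h1 : Real.log s + Real.log (a i) ≤ Real.log (s * a i + c) := by
        rw [← Real.log_mul hs.ne' h0.ne']
        exact Real.log_le_log (by positivity) (by linarith)
      have := mul_le_mul_of_nonneg_left h1 (diagCoeff_nonneg U hρ i)
      linarith
  · rw [show negTrLog ρ (conjDiag U a) = ⊤ from if_neg hker, EReal.top_add_coe]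
    exact le_top

theorem cfc_log_kronecker {A : Matrix m m ℂ} {B : Matrix n n ℂ} (hA : A.PosDef) (hB : B.PosDef) :
    cfc Real.log (A ⊗ₖ B) =
      cfc Real.log A ⊗ₖ (1 : Matrix n n ℂ) + (1 : Matrix m m ℂ) ⊗ₖ cfc Real.log B := by
  obtain ⟨U, hU, a, rfl⟩ := exists_eq_conjDiag hA.1
  obtain ⟨V, hV, b, rfl⟩ := exists_eq_conjDiag hB.1
  rw [conjDiag_posDef_iff hU] at hA
  rw [conjDiag_posDef_iff hV] at hB
  have h1 : (1 : Matrix m m ℂ) = conjDiag U (fun _ => 1) := by simp [conjDiag_const hU]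
  have h2 : (1 : Matrix n n ℂ) = conjDiag V (fun _ => 1) := by simp [conjDiag_const hV]
  rw [conjDiag_kronecker, cfc_conjDiag (kronecker_mem_unitary hU hV), cfc_conjDiag hU,
    cfc_conjDiag hV, h1, h2, conjDiag_kronecker, conjDiag_kronecker, ← conjDiag_add]
  congr 1
  ext x
  rw [Real.log_mul (hA _).ne' (hB _).ne']
  simp

/-- The tangent inequality for the logarithm, in any orthonormal basis. -/
theorem diagCoeff_cfc_log_le {A : Matrix n n ℂ} (hA : A.PosDef) {U : Matrix n n ℂ}
    (hU : U ∈ unitaryGroup n ℂ) {c : ℝ} (hc : 0 < c) (i : n) :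
    diagCoeff U (cfc Real.log A) i ≤ c⁻¹ * diagCoeff U A i + (Real.log c - 1) := by
  obtain ⟨R, hR, a, rfl⟩ := exists_eq_conjDiag hA.1
  rw [conjDiag_posDef_iff hR] at hA
  -- The matrix A/c + (log c - 1)·1 - log A has nonnegative eigenvalues; its diagonal is therefore
  -- nonnegative in every basis, not only in an eigenbasis of A.
  have h : (conjDiag R (fun k => (c⁻¹ * a k + (Real.log c - 1)) +
      (-1) * Real.log (a k))).PosSemidef := by
    refine conjDiag_posSemidef _ fun k => ?_
    have := Real.log_le_sub_one_of_pos (mul_pos (inv_pos.2 hc) (hA k))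
    rw [Real.log_mul (inv_pos.2 hc).ne' (hA k).ne', Real.log_inv] at this
    linarith
  have := diagCoeff_nonneg U h i
  rw [conjDiag_add R (fun k => c⁻¹ * a k + (Real.log c - 1)), conjDiag_add R (fun k => c⁻¹ * a k),
    conjDiag_smul, conjDiag_smul, conjDiag_const hR, diagCoeff_add, diagCoeff_add, diagCoeff_smul,
    diagCoeff_smul, diagCoeff_smul, diagCoeff_one hU] at this
  rw [cfc_conjDiag hR]
  linarith

end Spectral

/-! ### Corners, anti-blockers and their tensor products. -/

section Corners

variable {m n : Type*}

theorem posDef_smul_one [DecidableEq n] {c : ℝ} (hc : 0 < c) : (c • (1 : Matrix n n ℂ)).PosDef :=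
  PosDef.one.smul hc

theorem kronecker_mem_maxTensor {𝒜 : Set (Matrix m m ℂ)} {ℬ : Set (Matrix n n ℂ)}
    {A : Matrix m m ℂ} {B : Matrix n n ℂ} (hA : A ∈ 𝒜) (hB : B ∈ ℬ) :
    A ⊗ₖ B ∈ maxTensor 𝒜 ℬ :=
  fun _ h𝒞 => h𝒞.2 ⟨A, hA, B, hB, rfl⟩

theorem maxTensor_subset {𝒜 : Set (Matrix m m ℂ)} {ℬ : Set (Matrix n n ℂ)}
    {𝒞 : Set (Matrix (m × n) (m × n) ℂ)} (h𝒞 : IsConvexCorner 𝒞)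
    (h : ∀ A ∈ 𝒜, ∀ B ∈ ℬ, A ⊗ₖ B ∈ 𝒞) : maxTensor 𝒜 ℬ ⊆ 𝒞 :=
  Set.sInter_subset_of_mem ⟨h𝒞, by rintro _ ⟨A, hA, B, hB, rfl⟩; exact h A hA B hB⟩

variable [Fintype n]

theorem isClosed_setOf_posSemidef : IsClosed {A : Matrix n n ℂ | A.PosSemidef} := by
  have : {A : Matrix n n ℂ | A.PosSemidef} =
      {A | Aᴴ = A} ∩ ⋂ x : n → ℂ, {A | 0 ≤ star x ⬝ᵥ (A *ᵥ x)} := by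
    ext A
    simp [posSemidef_iff_dotProduct_mulVec, Matrix.IsHermitian]
  rw [this]
  refine (isClosed_eq continuous_id.matrix_conjTranspose continuous_id).inter
    (isClosed_iInter fun x => ?_)
  exact isClosed_le continuous_const
    (continuous_const.dotProduct (continuous_id.matrix_mulVec continuous_const))

theorem IsStandard.isCompact {𝒜 : Set (Matrix n n ℂ)} (h : IsStandard 𝒜) : IsCompact 𝒜 := by
  obtain ⟨R, hR⟩ := h.bounded
  have hc : IsCompact (Set.univ.pi fun _ : n => Set.univ.pi fun _ : n =>
      Metric.closedBall (0 : ℂ) (R + 1)) :=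
    isCompact_univ_pi fun _ => isCompact_univ_pi fun _ => isCompact_closedBall _ _
  refine hc.of_isClosed_subset h.isClosed fun A hA i _ j _ => ?_
  rw [mem_closedBall_zero_iff]
  have h1 : ‖A i j‖ ^ 2 ≤ hsNormSq A :=
    (Finset.single_le_sum (f := fun j => ‖A i j‖ ^ 2) (fun _ _ => by positivity)
      (Finset.mem_univ j)).trans
    (Finset.single_le_sum (f := fun i => ∑ j, ‖A i j‖ ^ 2)
      (fun _ _ => Finset.sum_nonneg fun _ _ => by positivity) (Finset.mem_univ i))
  nlinarith [hR A hA, sq_nonneg (‖A i j‖ - 1)]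

variable [Fintype m] [DecidableEq m] [DecidableEq n]

theorem trace_mul_nonneg {A B : Matrix n n ℂ} (hA : A.PosSemidef) (hB : B.PosSemidef) :
    0 ≤ (A * B).trace.re := by
  obtain ⟨U, hU, b, rfl⟩ := exists_eq_conjDiag hB.1
  rw [trace_mul_conjDiag]
  refine Finset.sum_nonneg fun i _ => mul_nonneg (diagCoeff_nonneg U hA i) ?_
  simpa [diagCoeff_conjDiag hU] using diagCoeff_nonneg U hB i

theorem isConvexCorner_antiBlocker {𝒮 : Set (Matrix n n ℂ)} (h𝒮 : ∀ M ∈ 𝒮, M.PosSemidef) :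
    IsConvexCorner (antiBlocker 𝒮) where
  nonempty := ⟨0, PosSemidef.zero, by simp⟩
  posSemidef _ hA := hA.1
  isClosed := by
    have : antiBlocker 𝒮 = {A | A.PosSemidef} ∩ ⋂ M ∈ 𝒮, {A | (A * M).trace.re ≤ 1} := by
      ext A
      simp [antiBlocker]
    rw [this]
    refine isClosed_setOf_posSemidef.inter (isClosed_biInter fun M _ => ?_)
    exact isClosed_le (Complex.continuous_re.comp
      (continuous_id.matrix_mul continuous_const).matrix_trace) continuous_const
  convex := by
    rintro A ⟨hA, hA'⟩ B ⟨hB, hB'⟩ s t hs ht hst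
    refine ⟨(hA.smul hs).add (hB.smul ht), fun M hM => ?_⟩
    have h1 := mul_le_mul_of_nonneg_left (hA' M hM) hs
    have h2 := mul_le_mul_of_nonneg_left (hB' M hM) ht
    simp only [add_mul, smul_mul_assoc, trace_add, trace_smul, Complex.add_re, Complex.smul_re,
      smul_eq_mul]
    linarith
  hereditary := by
    rintro A B ⟨_, hB⟩ hA hAB
    refine ⟨hA, fun M hM => ?_⟩
    have h1 := trace_mul_nonneg hAB (h𝒮 M hM)
    have h2 := hB M hM
    rw [sub_mul, trace_sub, Complex.sub_re] at h1
    linarith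

theorem posSemidef_of_mem_maxTensor {𝒜 : Set (Matrix m m ℂ)} {ℬ : Set (Matrix n n ℂ)}
    (h𝒜 : ∀ A ∈ 𝒜, A.PosSemidef) (hℬ : ∀ B ∈ ℬ, B.PosSemidef)
    {M : Matrix (m × n) (m × n) ℂ} (hM : M ∈ maxTensor 𝒜 ℬ) : M.PosSemidef := by
  -- The anti-blocker of the empty set is the whole positive semidefinite cone.
  have h : IsConvexCorner (antiBlocker (∅ : Set (Matrix (m × n) (m × n) ℂ))) :=
    isConvexCorner_antiBlocker (by simp)
  exact (maxTensor_subset h (fun A hA B hB =>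
    ⟨(h𝒜 A hA).kronecker (hℬ B hB), by simp⟩) hM).1

theorem isConvexCorner_minTensor (𝒜 : Set (Matrix m m ℂ)) (ℬ : Set (Matrix n n ℂ)) :
    IsConvexCorner (minTensor 𝒜 ℬ) :=
  isConvexCorner_antiBlocker fun _ =>
    posSemidef_of_mem_maxTensor (fun _ hA => hA.1) (fun _ hB => hB.1)

/-- The anti-blocker of the single matrix A ⊗ B is itself a corner, so it contains the hull of all N
⊗ N' once it contains these products. -/
theorem kronecker_mem_minTensor {𝒜 : Set (Matrix m m ℂ)} {ℬ : Set (Matrix n n ℂ)}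
    (h𝒜 : ∀ A ∈ 𝒜, A.PosSemidef) (hℬ : ∀ B ∈ ℬ, B.PosSemidef)
    {A : Matrix m m ℂ} {B : Matrix n n ℂ} (hA : A ∈ 𝒜) (hB : B ∈ ℬ) :
    A ⊗ₖ B ∈ minTensor 𝒜 ℬ := by
  have hAB := (h𝒜 A hA).kronecker (hℬ B hB)
  have h𝒞 : IsConvexCorner (antiBlocker {A ⊗ₖ B}) :=
    isConvexCorner_antiBlocker (by rintro _ rfl; exact hAB)
  have hsub : maxTensor (antiBlocker 𝒜) (antiBlocker ℬ) ⊆ antiBlocker {A ⊗ₖ B} := by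
    refine maxTensor_subset h𝒞 fun N hN N' hN' => ⟨hN.1.kronecker hN'.1, ?_⟩
    rintro _ rfl
    -- Real parts multiply only because one of the two traces is real.
    have him : (N * A).trace.im = 0 := by
      refine Complex.conj_eq_iff_im.1 ?_
      rw [starRingEnd_apply, ← trace_conjTranspose, conjTranspose_mul, hN.1.1.eq, (h𝒜 A hA).1.eq,
        trace_mul_comm]
    rw [← mul_kronecker_mul, trace_kronecker, Complex.mul_re, him, zero_mul, sub_zero]
    exact mul_le_one₀ (hN.2 A hA) (trace_mul_nonneg hN'.1 (hℬ B hB)) (hN'.2 B hB)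
  refine ⟨hAB, fun M hM => ?_⟩
  rw [trace_mul_comm]
  exact (hsub hM).2 _ rfl

theorem maxTensor_subset_minTensor {𝒜 : Set (Matrix m m ℂ)} {ℬ : Set (Matrix n n ℂ)}
    (h𝒜 : ∀ A ∈ 𝒜, A.PosSemidef) (hℬ : ∀ B ∈ ℬ, B.PosSemidef) :
    maxTensor 𝒜 ℬ ⊆ minTensor 𝒜 ℬ :=
  maxTensor_subset (isConvexCorner_minTensor 𝒜 ℬ) fun _ hA _ hB =>
    kronecker_mem_minTensor h𝒜 hℬ hA hB

theorem hsNormSq_smul_one (t : ℝ) :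
    hsNormSq (t • (1 : Matrix n n ℂ)) = Fintype.card n * t ^ 2 := by
  have : ∀ i j : n, ‖(t • (1 : Matrix n n ℂ)) i j‖ ^ 2 = if i = j then t ^ 2 else 0 := by
    intro i j
    by_cases h : i = j <;> simp [h]
  simp only [hsNormSq, this]
  simp

theorem IsStandard.exists_smul_one_mem {𝒜 : Set (Matrix n n ℂ)} (h : IsStandard 𝒜) :
    ∃ c : ℝ, 0 < c ∧ c • (1 : Matrix n n ℂ) ∈ 𝒜 := by
  obtain ⟨A, hA, δ, hδ, hball⟩ := h.relInterior
  have hd : (0 : ℝ) < Fintype.card n + 1 := by positivity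
  have ht : 0 < δ / (Fintype.card n + 1) := by positivity
  refine ⟨δ / (Fintype.card n + 1), ht, ?_⟩
  have h1 : ((δ / (Fintype.card n + 1)) • (1 : Matrix n n ℂ)).PosSemidef :=
    PosSemidef.one.smul ht.le
  -- The ball is centred at `A`, so it contains A + t·1, which dominates t·1. The choice t = δ/(d+1)
  -- works because d < (d+1)², also for d = 0.
  refine h.hereditary _ (A + (δ / (Fintype.card n + 1)) • 1) (hball _ ((h.posSemidef A hA).add h1)
    ?_) h1 (by simpa using h.posSemidef A hA)
  rw [add_sub_cancel_left, hsNormSq_smul_one, div_pow, ← mul_div_assoc, div_lt_iff₀ (by positivity),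
    mul_comm]
  have : (0 : ℝ) ≤ Fintype.card n := by positivity
  have : (Fintype.card n : ℝ) < (Fintype.card n + 1) ^ 2 := by nlinarith
  exact mul_lt_mul_of_pos_left this (by positivity)

/-! ### Marginals and subadditivity of the entropy. -/

theorem reduced₁_isState {ρ : Matrix (m × n) (m × n) ℂ} (hρ : IsState ρ) :
    IsState (reduced₁ ρ) := by
  refine ⟨?_, ?_⟩
  · have : reduced₁ ρ = ∑ j, ρ.submatrix (fun i => (i, j)) (fun i => (i, j)) := by
      ext i i'
      simp [reduced₁, Matrix.sum_apply]
    rw [this]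
    exact posSemidef_sum _ fun j _ => hρ.1.submatrix _
  · have := trace_reduced₁_mul ρ 1
    rwa [one_kronecker_one, mul_one, mul_one, hρ.2] at this

theorem reduced₂_isState {ρ : Matrix (m × n) (m × n) ℂ} (hρ : IsState ρ) :
    IsState (reduced₂ ρ) := by
  refine ⟨?_, ?_⟩
  · have : reduced₂ ρ = ∑ i, ρ.submatrix (fun j => (i, j)) (fun j => (i, j)) := by
      ext j j'
      simp [reduced₂, Matrix.sum_apply]
    rw [this]
    exact posSemidef_sum _ fun j _ => hρ.1.submatrix _
  · have := trace_reduced₂_mul ρ 1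
    rwa [one_kronecker_one, mul_one, mul_one, hρ.2] at this

/-- The entropy is approached along positive definite members of the corner. -/
theorem exists_posDef_negTrLog_lt {𝒜 : Set (Matrix n n ℂ)} (h : IsConvexCorner 𝒜) {c : ℝ}
    (hc : 0 < c) (hc𝒜 : c • (1 : Matrix n n ℂ) ∈ 𝒜) {ρ : Matrix n n ℂ} (hρ : IsState ρ)
    {x : EReal} (hx : entropy 𝒜 ρ < x) : ∃ A ∈ 𝒜, A.PosDef ∧ negTrLog ρ A < x := by
  obtain ⟨A, hA⟩ := iInf_lt_iff.1 hx
  obtain ⟨hA𝒜, hAx⟩ := iInf_lt_iff.1 hA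
  have hne : negTrLog ρ A ≠ ⊥ := by
    rw [negTrLog]
    split_ifs
    · exact EReal.coe_ne_bot _
    · exact top_ne_bot
  obtain ⟨y, hy, hyx⟩ := EReal.lt_iff_exists_real_btwn.1 hAx
  lift negTrLog ρ A to ℝ using ⟨hAx.ne_top, hne⟩ with r hr
  have hry : r < y := by exact_mod_cast hy
  have hs1 : Real.exp (-(y - r)) < 1 := Real.exp_lt_one_iff.2 (by linarith)
  have hs := Real.exp_pos (-(y - r))
  have hpos : 0 < (1 - Real.exp (-(y - r))) * c := mul_pos (by linarith) hc
  -- The weight s = exp(-(y - r)) has -log s = y - r, exactly the slack between `r` and `y`.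
  refine ⟨Real.exp (-(y - r)) • A + ((1 - Real.exp (-(y - r))) * c) • 1, ?_, ?_, ?_⟩
  · rw [mul_smul]
    exact h.convex hA𝒜 hc𝒜 hs.le (by linarith) (by ring)
  · exact PosDef.posSemidef_add ((h.posSemidef A hA𝒜).smul hs.le) (posDef_smul_one hpos)
  · refine (negTrLog_smul_add_le hρ.1 (h.posSemidef A hA𝒜) hs hpos).trans_lt ?_
    rw [← hr, hρ.2, Real.log_exp, ← EReal.coe_add]
    simpa using hyx

/-- Excludes the ambiguous sum ⊤ + ⊥ when two entropies are added in `EReal`. -/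
theorem entropy_ne_top {𝒜 : Set (Matrix n n ℂ)} {c : ℝ} (hc : 0 < c)
    (hc𝒜 : c • (1 : Matrix n n ℂ) ∈ 𝒜) (ρ : Matrix n n ℂ) : entropy 𝒜 ρ ≠ ⊤ := by
  have h : entropy 𝒜 ρ ≤ negTrLog ρ (c • 1) := iInf₂_le _ hc𝒜
  rw [negTrLog_of_posDef ρ (posDef_smul_one hc)] at h
  exact (h.trans_lt (EReal.coe_lt_top _)).ne

theorem negTrLog_kronecker (ρ : Matrix (m × n) (m × n) ℂ) {A : Matrix m m ℂ} {B : Matrix n n ℂ}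
    (hA : A.PosDef) (hB : B.PosDef) :
    negTrLog ρ (A ⊗ₖ B) = negTrLog (reduced₁ ρ) A + negTrLog (reduced₂ ρ) B := by
  rw [negTrLog_of_posDef _ (hA.kronecker hB), negTrLog_of_posDef _ hA, negTrLog_of_posDef _ hB,
    cfc_log_kronecker hA hB, mul_add, trace_add, ← trace_reduced₁_mul, ← trace_reduced₂_mul,
    ← EReal.coe_add, Complex.add_re, neg_add]

theorem entropy_le_add {𝒜 : Set (Matrix m m ℂ)} {ℬ : Set (Matrix n n ℂ)}
    (h𝒜 : IsStandard 𝒜) (hℬ : IsStandard ℬ) {𝒯 : Set (Matrix (m × n) (m × n) ℂ)}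
    (h𝒯 : ∀ A ∈ 𝒜, ∀ B ∈ ℬ, A ⊗ₖ B ∈ 𝒯) {ρ : Matrix (m × n) (m × n) ℂ} (hρ : IsState ρ) :
    entropy 𝒯 ρ ≤ entropy 𝒜 (reduced₁ ρ) + entropy ℬ (reduced₂ ρ) := by
  obtain ⟨c, hc, hc𝒜⟩ := h𝒜.exists_smul_one_mem
  obtain ⟨e, he, heℬ⟩ := hℬ.exists_smul_one_mem
  refine EReal.le_add_of_forall_gt (Or.inr (entropy_ne_top he heℬ _))
    (Or.inl (entropy_ne_top hc hc𝒜 _)) fun a ha b hb => ?_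
  obtain ⟨A, hA, hA', hAa⟩ :=
    exists_posDef_negTrLog_lt h𝒜.toIsConvexCorner hc hc𝒜 (reduced₁_isState hρ) ha
  obtain ⟨B, hB, hB', hBb⟩ :=
    exists_posDef_negTrLog_lt hℬ.toIsConvexCorner he heℬ (reduced₂_isState hρ) hb
  calc entropy 𝒯 ρ ≤ negTrLog ρ (A ⊗ₖ B) := iInf₂_le _ (h𝒯 A hA B hB)
    _ = negTrLog (reduced₁ ρ) A + negTrLog (reduced₂ ρ) B := negTrLog_kronecker ρ hA' hB'
    _ ≤ a + b := add_le_add hAa.le hBb.le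

end Corners

/-! ### The lower bound: optimality certificates for diagonal states. -/

/-- First order optimality for the maximisation of a weighted sum of logarithms on a segment. -/
theorem sum_mul_div_le_one {ι : Type*} [Fintype ι] {p a b : ι → ℝ} (hp : ∀ i, 0 ≤ p i)
    (hp1 : ∑ i, p i = 1) (ha : ∀ i, 0 < p i → 0 < a i) (hb : ∀ i, 0 ≤ b i)
    (hmax : ∀ t ∈ Set.Ioo (0 : ℝ) 1,
      ∏ i, ((1 - t) * a i + t * b i) ^ p i ≤ ∏ i, a i ^ p i) :
    ∑ i, p i * (b i / a i) ≤ 1 := by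
  have hle : ∀ t ∈ Set.Ioo (0 : ℝ) 1,
      ∑ i, p i * ((b i / a i - 1) / (1 + t * (b i / a i - 1))) ≤ 0 := by
    intro t ht
    have hbase : ∀ i, 0 < p i → 0 < 1 + t * (b i / a i - 1) := fun i h => by
      have := div_nonneg (hb i) (ha i h).le
      nlinarith [ht.1, ht.2]
    have hprod : ∏ i, (1 + t * (b i / a i - 1)) ^ p i ≤ 1 := by
      have hpos : 0 < ∏ i, a i ^ p i := Finset.prod_pos fun i _ => by
        rcases (hp i).eq_or_lt with h | h
        · simp [← h]
        · exact Real.rpow_pos_of_pos (ha i h) _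
      have heq : ∏ i, ((1 - t) * a i + t * b i) ^ p i =
          (∏ i, a i ^ p i) * ∏ i, (1 + t * (b i / a i - 1)) ^ p i := by
        rw [← Finset.prod_mul_distrib]
        refine Finset.prod_congr rfl fun i _ => ?_
        rcases (hp i).eq_or_lt with h | h
        · simp [← h]
        · have h0 := ha i h
          rw [← Real.mul_rpow h0.le (hbase i h).le]
          congr 1
          field_simp
          ring
      have := hmax t ht
      rw [heq] at this
      exact le_of_mul_le_mul_left (by simpa using this) hpos
    have hlog : ∑ i, p i * Real.log (1 + t * (b i / a i - 1)) ≤ 0 := by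
      have hpos : ∀ i, 0 < (1 + t * (b i / a i - 1)) ^ p i := fun i => by
        rcases (hp i).eq_or_lt with h | h
        · simp [← h]
        · exact Real.rpow_pos_of_pos (hbase i h) _
      have h1 := Real.log_nonpos (Finset.prod_pos fun i _ => hpos i).le hprod
      rw [Real.log_prod fun i _ => (hpos i).ne'] at h1
      refine (Finset.sum_congr rfl fun i _ => ?_).trans_le h1
      rcases (hp i).eq_or_lt with h | h
      · simp [← h]
      · rw [Real.log_rpow (hbase i h)]
    -- The inequality 1 - 1/u ≤ log u at u = 1 + t(bᵢ/aᵢ - 1) gives a one-sided bound on the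
    -- difference quotient; letting t → 0⁺ then replaces differentiation.
    have hterm : ∀ i, t * (p i * ((b i / a i - 1) / (1 + t * (b i / a i - 1)))) ≤
        p i * Real.log (1 + t * (b i / a i - 1)) := fun i => by
      rcases (hp i).eq_or_lt with h | h
      · simp [← h]
      · have h2 := hbase i h
        have h3 := mul_le_mul_of_nonneg_left (Real.one_sub_inv_le_log_of_pos h2) h.le
        refine le_trans (le_of_eq ?_) h3
        field_simp
        ring
    have h2 := (Finset.sum_le_sum fun i _ => hterm i).trans hlog
    rw [← Finset.mul_sum] at h2
    exact nonpos_of_mul_nonpos_right h2 ht.1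
  have hlim : Filter.Tendsto
      (fun t : ℝ => ∑ i, p i * ((b i / a i - 1) / (1 + t * (b i / a i - 1))))
      (nhdsWithin 0 (Set.Ioi 0))
      (nhds (∑ i, p i * ((b i / a i - 1) / (1 + 0 * (b i / a i - 1))))) := by
    refine tendsto_nhdsWithin_of_tendsto_nhds (ContinuousAt.tendsto (f := fun t : ℝ =>
      ∑ i, p i * ((b i / a i - 1) / (1 + t * (b i / a i - 1)))) ?_)
    refine tendsto_finsetSum _ fun i _ => ?_
    exact continuousAt_const.mul (continuousAt_const.div (by fun_prop) (by simp))
  have h0 := le_of_tendsto hlim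
    (Filter.mem_of_superset (Ioo_mem_nhdsGT one_pos) hle)
  simp only [zero_mul, add_zero, div_one] at h0
  simp only [mul_sub_one, Finset.sum_sub_distrib, hp1] at h0
  linarith

/-- The unitary matrix whose columns are the vectors of an orthonormal basis. -/
noncomputable def basisMatrix {n : Type*} [Fintype n]
    (V : OrthonormalBasis n ℂ (EuclideanSpace ℂ n)) : Matrix n n ℂ :=
  Matrix.of fun i j => V j i

section Additivity

variable {m n : Type*} [Fintype m] [DecidableEq m] [Fintype n] [DecidableEq n]

/-- The optimal member of a standard corner for a state that is diagonal in the basis given by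
`U`, and the member of the anti-blocker that certifies its optimality. -/
theorem IsStandard.exists_optimal {𝒜 : Set (Matrix n n ℂ)} (h : IsStandard 𝒜) {U : Matrix n n ℂ}
    (hU : U ∈ unitaryGroup n ℂ) {p : n → ℝ} (hp : ∀ i, 0 ≤ p i) (hp1 : ∑ i, p i = 1) :
    ∃ A ∈ 𝒜, (∀ i, 0 < p i → 0 < diagCoeff U A i) ∧
      conjDiag U (fun i => p i / diagCoeff U A i) ∈ antiBlocker 𝒜 := by
  -- The product of powers, unlike the sum of logarithms, is continuous up to vanishing entries, and
  -- entries of weight zero contribute 1.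
  obtain ⟨A, hA, hmax⟩ := h.isCompact.exists_isMaxOn h.nonempty
    (f := fun A => ∏ i, diagCoeff U A i ^ p i)
    (continuous_finsetProd _ fun i _ =>
      (Real.continuous_rpow_const (hp i)).comp (continuous_diagCoeff U i)).continuousOn
  have hnn : ∀ B ∈ 𝒜, ∀ i, 0 ≤ diagCoeff U B i := fun B hB =>
    diagCoeff_nonneg U (h.posSemidef B hB)
  -- A vanishing entry of positive weight would make the maximum 0, yet c·1 gives a positive value.
  have hpos : ∀ i, 0 < p i → 0 < diagCoeff U A i := fun i hi => by
    refine (hnn A hA i).lt_of_ne' fun h0 => ?_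
    obtain ⟨c, hc, hc𝒜⟩ := h.exists_smul_one_mem
    have h1 : ∏ j, diagCoeff U (c • 1) j ^ p j ≤ ∏ j, diagCoeff U A j ^ p j := hmax hc𝒜
    have h2 : ∏ j, diagCoeff U A j ^ p j = 0 :=
      Finset.prod_eq_zero (Finset.mem_univ i) (by rw [h0, Real.zero_rpow hi.ne'])
    rw [h2] at h1
    refine h1.not_gt (Finset.prod_pos fun j _ => ?_)
    rw [diagCoeff_smul, diagCoeff_one hU, mul_one]
    exact Real.rpow_pos_of_pos hc _
  refine ⟨A, hA, hpos, conjDiag_posSemidef _ fun i => div_nonneg (hp i) (hnn A hA i),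
    fun B hB => ?_⟩
  rw [trace_mul_comm, trace_mul_conjDiag]
  refine (Finset.sum_congr rfl fun i _ => ?_).trans_le (sum_mul_div_le_one hp hp1 hpos (hnn B hB)
    fun t ht => ?_)
  · ring
  · have hmem := h.convex hA hB (by linarith [ht.2] : 0 ≤ 1 - t) ht.1.le (by ring)
    have h1 : ∏ i, diagCoeff U ((1 - t) • A + t • B) i ^ p i ≤ ∏ i, diagCoeff U A i ^ p i :=
      hmax hmem
    simpa only [diagCoeff_add, diagCoeff_smul] using h1

theorem entropy_conjDiag_le {𝒜 : Set (Matrix n n ℂ)} {U : Matrix n n ℂ}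
    (hU : U ∈ unitaryGroup n ℂ) {p a : n → ℝ} (hpa : ∀ i, a i = 0 → p i = 0)
    (ha : conjDiag U a ∈ 𝒜) :
    entropy 𝒜 (conjDiag U p) ≤ ((-∑ i, p i * Real.log (a i) : ℝ) : EReal) := by
  refine (iInf₂_le _ ha).trans_eq ?_
  have hker : ∀ v : n → ℂ, conjDiag U a *ᵥ v = 0 → conjDiag U p *ᵥ v = 0 := fun v hv => by
    rw [conjDiag_mulVec_eq_zero_iff hU] at hv ⊢
    exact fun i => (hv i).imp_left (hpa i)
  rw [negTrLog, if_pos hker, trace_mul_cfc_conjDiag hU]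
  simp only [diagCoeff_conjDiag hU]

/-- The lower bound for the entropy of a product of diagonal states over the minimal tensor
product, in terms of diagonalising unitaries. -/
theorem add_le_entropy_minTensor {𝒜 : Set (Matrix m m ℂ)} {ℬ : Set (Matrix n n ℂ)}
    (h𝒜 : IsStandard 𝒜) (hℬ : IsStandard ℬ) {U : Matrix m m ℂ} {V : Matrix n n ℂ}
    (hU : U ∈ unitaryGroup m ℂ) (hV : V ∈ unitaryGroup n ℂ)
    (hU𝒜 : ∀ A ∈ 𝒜, conjDiag U (diagCoeff U A) ∈ 𝒜)
    (hVℬ : ∀ B ∈ ℬ, conjDiag V (diagCoeff V B) ∈ ℬ)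
    {p : m → ℝ} {q : n → ℝ} (hp : ∀ i, 0 ≤ p i) (hp1 : ∑ i, p i = 1) (hq : ∀ j, 0 ≤ q j)
    (hq1 : ∑ j, q j = 1) :
    entropy 𝒜 (conjDiag U p) + entropy ℬ (conjDiag V q) ≤
      entropy (minTensor 𝒜 ℬ) (conjDiag U p ⊗ₖ conjDiag V q) := by
  obtain ⟨A, hA, hApos, hN⟩ := h𝒜.exists_optimal hU hp hp1
  obtain ⟨B, hB, hBpos, hN'⟩ := hℬ.exists_optimal hV hq hq1
  set a := diagCoeff U A
  set b := diagCoeff V B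
  have hpa : ∀ i, a i = 0 → p i = 0 := fun i hi => by
    by_contra h
    exact (hApos i ((hp i).lt_of_ne' h)).ne' hi
  have hqb : ∀ j, b j = 0 → q j = 0 := fun j hj => by
    by_contra h
    exact (hBpos j ((hq j).lt_of_ne' h)).ne' hj
  refine (add_le_add (entropy_conjDiag_le hU hpa (hU𝒜 A hA))
    (entropy_conjDiag_le hV hqb (hVℬ B hB))).trans ?_
  rw [← EReal.coe_add]
  -- A strict violation is witnessed by a positive definite `M`, to which the tangent inequality
  -- applies.
  by_contra! hlt
  have hUV := kronecker_mem_unitary hU hV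
  have hprod : ∀ (f : m → ℝ) (g : n → ℝ), ∑ x : m × n, f x.1 * g x.2 = (∑ i, f i) * ∑ j, g j :=
    fun f g => by rw [Fintype.sum_prod_type, Finset.sum_mul_sum]
  have hpq1 : ∑ x : m × n, p x.1 * q x.2 = 1 := by rw [hprod, hp1, hq1, one_mul]
  have hρ : IsState (conjDiag U p ⊗ₖ conjDiag V q) := by
    have hps : (conjDiag U p ⊗ₖ conjDiag V q).PosSemidef :=
      (conjDiag_posSemidef U hp).kronecker (conjDiag_posSemidef V hq)
    refine ⟨hps, Complex.ext ?_ ?_⟩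
    · rw [conjDiag_kronecker, ← sum_diagCoeff hUV]
      simpa [diagCoeff_conjDiag hUV] using hpq1
    · simpa using (Complex.le_def.1 hps.trace_nonneg).2.symm
  obtain ⟨c, hc, hc𝒜⟩ := h𝒜.exists_smul_one_mem
  obtain ⟨e, he, heℬ⟩ := hℬ.exists_smul_one_mem
  have hce : (c * e) • (1 : Matrix (m × n) (m × n) ℂ) ∈ minTensor 𝒜 ℬ := by
    have := kronecker_mem_minTensor h𝒜.posSemidef hℬ.posSemidef hc𝒜 heℬ
    rwa [smul_kronecker, kronecker_smul, one_kronecker_one, smul_smul] at this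
  obtain ⟨M, hM, hMpos, hMlt⟩ := exists_posDef_negTrLog_lt (isConvexCorner_minTensor 𝒜 ℬ)
    (mul_pos hc he) hce hρ hlt
  rw [negTrLog_of_posDef _ hMpos, EReal.coe_lt_coe_iff, trace_mul_comm, conjDiag_kronecker,
    trace_mul_conjDiag] at hMlt
  have hle := hM.2 _ (kronecker_mem_maxTensor hN hN')
  rw [conjDiag_kronecker, trace_mul_conjDiag] at hle
  -- Tangent at c = ab, weighted by pq. Summed, the first term is at most 1 by `hle`, which cancels
  -- the total -1 of the last.
  have hterm : ∀ x : m × n, diagCoeff (U ⊗ₖ V) (cfc Real.log M) x * (p x.1 * q x.2) ≤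
      diagCoeff (U ⊗ₖ V) M x * (p x.1 / a x.1 * (q x.2 / b x.2)) +
        (p x.1 * Real.log (a x.1) * q x.2 + p x.1 * (q x.2 * Real.log (b x.2)) -
          p x.1 * q x.2) := by
    intro x
    rcases (hp x.1).eq_or_lt with h | h
    · simp [← h]
    rcases (hq x.2).eq_or_lt with h' | h'
    · simp [← h']
    have ha := hApos _ h
    have hb := hBpos _ h'
    refine (mul_le_mul_of_nonneg_right (diagCoeff_cfc_log_le hMpos hUV (mul_pos ha hb) x)
      (mul_pos h h').le).trans_eq ?_
    rw [Real.log_mul ha.ne' hb.ne']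
    field_simp
  have hsum := Finset.sum_le_sum fun x (_ : x ∈ Finset.univ) => hterm x
  have h1 : ∑ x : m × n, p x.1 * Real.log (a x.1) * q x.2 = ∑ i, p i * Real.log (a i) := by
    rw [hprod (fun i => p i * Real.log (a i)), hq1, mul_one]
  have h2 : ∑ x : m × n, p x.1 * (q x.2 * Real.log (b x.2)) = ∑ j, q j * Real.log (b j) := by
    rw [hprod p (fun j => q j * Real.log (b j)), hp1, one_mul]
  rw [Finset.sum_add_distrib, Finset.sum_sub_distrib, Finset.sum_add_distrib, h1, h2, hpq1] at hsum
  linarith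

/-! ### Translation between orthonormal bases and unitary matrices. -/

theorem basisMatrix_mem_unitaryGroup (V : OrthonormalBasis n ℂ (EuclideanSpace ℂ n)) :
    basisMatrix V ∈ unitaryGroup n ℂ := by
  rw [mem_unitaryGroup_iff']
  ext i j
  have := orthonormal_iff_ite.1 V.orthonormal i j
  rw [EuclideanSpace.inner_eq_star_dotProduct] at this
  rw [one_apply, ← this]
  simp [basisMatrix, Matrix.mul_apply, dotProduct, mul_comm]

theorem sum_smul_rankOne (V : OrthonormalBasis n ℂ (EuclideanSpace ℂ n)) (d : n → ℂ) :
    ∑ i, d i • rankOne (V i) = basisMatrix V * diagonal d * star (basisMatrix V) := by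
  ext i j
  rw [Matrix.sum_apply, Matrix.mul_apply]
  refine Finset.sum_congr rfl fun k _ => ?_
  rw [mul_diagonal, Matrix.smul_apply, rankOne, vecMulVec_apply, star_apply, smul_eq_mul]
  simp only [basisMatrix, of_apply, Pi.star_apply]
  ring

theorem diagExpectation_eq (V : OrthonormalBasis n ℂ (EuclideanSpace ℂ n)) {A : Matrix n n ℂ}
    (hA : A.PosSemidef) :
    diagExpectation V A = conjDiag (basisMatrix V) (diagCoeff (basisMatrix V) A) := by
  rw [diagExpectation, sum_smul_rankOne, conjDiag]
  congr 3
  ext i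
  have h1 : star (V i).ofLp ⬝ᵥ (A *ᵥ (V i).ofLp) =
      (star (basisMatrix V) * A * basisMatrix V) i i := by
    rw [mul_assoc]
    rfl
  rw [h1, diagCoeff]
  -- Diagonal entries of a Hermitian matrix are real, so `diagCoeff` loses nothing.
  refine (Complex.conj_eq_iff_re.1 ?_).symm
  have := (isHermitian_conjTranspose_mul_mul (basisMatrix V) hA.1).apply i i
  exact this

/-- A matrix diagonal in V is fixed by the diagonal expectation, so its diagonal entries serve as
`p`. -/
theorem exists_eq_conjDiag_of_mem_diagonalIn {V : OrthonormalBasis n ℂ (EuclideanSpace ℂ n)}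
    {ρ : Matrix n n ℂ} (hρ : IsState ρ) (h : ρ ∈ diagonalIn V) :
    ∃ p : n → ℝ, (∀ i, 0 ≤ p i) ∧ ∑ i, p i = 1 ∧ ρ = conjDiag (basisMatrix V) p := by
  have hU := basisMatrix_mem_unitaryGroup V
  obtain ⟨d, hd⟩ := (Submodule.mem_span_range_iff_exists_fun ℂ).1 h
  refine ⟨diagCoeff (basisMatrix V) ρ, diagCoeff_nonneg _ hρ.1, ?_, ?_⟩
  · rw [sum_diagCoeff hU, hρ.2, Complex.one_re]
  · rw [← diagExpectation_eq V hρ.1, diagExpectation]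
    rw [← hd]
    refine Finset.sum_congr rfl fun i _ => ?_
    congr 1
    have h1 : star (V i).ofLp ⬝ᵥ (ρ *ᵥ (V i).ofLp) =
        (star (basisMatrix V) * ρ * basisMatrix V) i i := by
      rw [mul_assoc]
      rfl
    have h' := mem_unitaryGroup_iff'.1 hU
    rw [hd, h1, ← hd, sum_smul_rankOne, mul_assoc, mul_assoc, h', mul_one, ← mul_assoc, h', one_mul,
      diagonal_apply_eq]

end Additivity

theorem reduced₁_kronecker {m n : Type*} [Fintype n] (A : Matrix m m ℂ) {B : Matrix n n ℂ}
    (hB : B.trace = 1) : reduced₁ (A ⊗ₖ B) = A := by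
  ext i i'
  simp only [reduced₁, of_apply, kroneckerMap_apply, ← Finset.mul_sum]
  exact (congrArg _ hB).trans (mul_one _)

theorem reduced₂_kronecker {m n : Type*} [Fintype m] {A : Matrix m m ℂ} (B : Matrix n n ℂ)
    (hA : A.trace = 1) : reduced₂ (A ⊗ₖ B) = B := by
  ext j j'
  simp only [reduced₂, of_apply, kroneckerMap_apply, ← Finset.sum_mul]
  exact (congrArg (· * B j j') hA).trans (one_mul _)

theorem IsState.kronecker {m n : Type*} [Fintype m] [Fintype n]
    {ρ : Matrix m m ℂ} {σ : Matrix n n ℂ} (hρ : IsState ρ) (hσ : IsState σ) :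
    IsState (ρ ⊗ₖ σ) := by
  classical
  exact ⟨hρ.1.kronecker hσ.1, by rw [trace_kronecker, hρ.2, hσ.2, one_mul]⟩

end ConvexCorner

theorem mainTheorem8 (d₁ d₂ : ℕ)
    (𝒜₁ : Set (Matrix (Fin d₁) (Fin d₁) ℂ)) (𝒜₂ : Set (Matrix (Fin d₂) (Fin d₂) ℂ))
    (h₁ : ConvexCorner.IsStandard 𝒜₁) (h₂ : ConvexCorner.IsStandard 𝒜₂) :
    (∀ ρ : Matrix (Fin d₁ × Fin d₂) (Fin d₁ × Fin d₂) ℂ, ConvexCorner.IsState ρ →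
      ConvexCorner.entropy (ConvexCorner.maxTensor 𝒜₁ 𝒜₂) ρ ≤
          ConvexCorner.entropy 𝒜₁ (ConvexCorner.reduced₁ ρ) +
            ConvexCorner.entropy 𝒜₂ (ConvexCorner.reduced₂ ρ) ∧
      ConvexCorner.entropy (ConvexCorner.minTensor 𝒜₁ 𝒜₂) ρ ≤
          ConvexCorner.entropy 𝒜₁ (ConvexCorner.reduced₁ ρ) +
            ConvexCorner.entropy 𝒜₂ (ConvexCorner.reduced₂ ρ)) ∧
    (∀ (V₁ : OrthonormalBasis (Fin d₁) ℂ (EuclideanSpace ℂ (Fin d₁)))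
        (V₂ : OrthonormalBasis (Fin d₂) ℂ (EuclideanSpace ℂ (Fin d₂)))
        (ρ₁ : Matrix (Fin d₁) (Fin d₁) ℂ) (ρ₂ : Matrix (Fin d₂) (Fin d₂) ℂ),
      ConvexCorner.IsState ρ₁ → ConvexCorner.IsState ρ₂ →
      ρ₁ ∈ ConvexCorner.diagonalIn V₁ → ρ₂ ∈ ConvexCorner.diagonalIn V₂ →
      ConvexCorner.IsAligned V₁ 𝒜₁ → ConvexCorner.IsAligned V₂ 𝒜₂ →
      ConvexCorner.entropy (ConvexCorner.maxTensor 𝒜₁ 𝒜₂) (ρ₁ ⊗ₖ ρ₂) =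
          ConvexCorner.entropy 𝒜₁ ρ₁ + ConvexCorner.entropy 𝒜₂ ρ₂ ∧
      ConvexCorner.entropy (ConvexCorner.minTensor 𝒜₁ 𝒜₂) (ρ₁ ⊗ₖ ρ₂) =
          ConvexCorner.entropy 𝒜₁ ρ₁ + ConvexCorner.entropy 𝒜₂ ρ₂) := by
  open ConvexCorner in
  have hmax : ∀ ρ : Matrix (Fin d₁ × Fin d₂) (Fin d₁ × Fin d₂) ℂ, IsState ρ →
      entropy (maxTensor 𝒜₁ 𝒜₂) ρ ≤ entropy 𝒜₁ (reduced₁ ρ) + entropy 𝒜₂ (reduced₂ ρ) :=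
    fun ρ hρ => entropy_le_add h₁ h₂ (fun A hA B hB => kronecker_mem_maxTensor hA hB) hρ
  have hminmax : ∀ ρ, entropy (minTensor 𝒜₁ 𝒜₂) ρ ≤ entropy (maxTensor 𝒜₁ 𝒜₂) ρ :=
    fun ρ => biInf_mono (maxTensor_subset_minTensor h₁.posSemidef h₂.posSemidef)
  refine ⟨fun ρ hρ => ⟨hmax ρ hρ, (hminmax ρ).trans (hmax ρ hρ)⟩, ?_⟩
  intro V₁ V₂ ρ₁ ρ₂ hρ₁ hρ₂ hd₁ hd₂ hV₁ hV₂
  have hle := hmax _ (hρ₁.kronecker hρ₂)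
  rw [reduced₁_kronecker ρ₁ hρ₂.2, reduced₂_kronecker ρ₂ hρ₁.2] at hle
  have hge : entropy 𝒜₁ ρ₁ + entropy 𝒜₂ ρ₂ ≤ entropy (minTensor 𝒜₁ 𝒜₂) (ρ₁ ⊗ₖ ρ₂) := by
    obtain ⟨p, hp, hp1, rfl⟩ := exists_eq_conjDiag_of_mem_diagonalIn hρ₁ hd₁
    obtain ⟨q, hq, hq1, rfl⟩ := exists_eq_conjDiag_of_mem_diagonalIn hρ₂ hd₂
    refine add_le_entropy_minTensor h₁ h₂ (basisMatrix_mem_unitaryGroup V₁)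
      (basisMatrix_mem_unitaryGroup V₂) (fun A hA => ?_) (fun B hB => ?_) hp hp1 hq hq1
    · exact diagExpectation_eq V₁ (h₁.posSemidef A hA) ▸ hV₁ A hA
    · exact diagExpectation_eq V₂ (h₂.posSemidef B hB) ▸ hV₂ B hB
  -- Sum of entropies ≤ minimal ≤ maximal ≤ sum of entropies, so all are equal.
  exact ⟨hle.antisymm (hge.trans (hminmax _)), ((hminmax _).trans hle).antisymm hge⟩
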